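/- An inversion sequence of length $n$ is an integer sequence $\sigma=(\sigma_1,\dots,\sigma_n)$ with $\sigma_i\in\{0,\dots,i-1\}$ for all $i$. A Cayley permutation of length $n$ is an integer sequence $\rho=(\rho_1,\dots,\rho_n)$ whose set of values is exactly $\{0,\dots,\max(\rho)\}$ (the empty sequence counts as one); $\mathcal P_n$ denotes the set of these. A sequence $\sigma$ contains a sequence $\tau$, written $\tau\preceq\sigma$, if some subsequence of $\sigma$ is order-isomorphic to $\tau$ (with equal entries corresponding to equal entries). For a nonempty sequence $\rho$ of nonnegative integers of length $k$, let $\mathbf{mdd}(\rho)=\max_{1\le i\le k}(\rho_i-i+1)$. For a nonempty Cayley permutation $\rho$, a $\rho$-minimal inversion sequence is a minimal element, with respect to $\preceq$, of the set of all inversion sequences (of any length) that are Cayley permutations and contain $\rho$. For $n,m\ge 0$, let $\mathcal A_{n,m}$ be the set of pairs consisting of an inversion sequence $\alpha$ of length $n$ and a colouring of the values $0,\dots,n-1$ (whether or not they occur in $\alpha$) such that each value is blue or red, exactly $m$ values are blue and $n-m$ are red, and each red value occurs at least twice in $\alpha$. (Thus $\mathcal A_{n,m}=\emptyset$ if $n<m$.)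 **Proposition.** Let $k\ge 1$, $m\ge 0$, and let $\rho\in\mathcal P_k$ be such that $\rho_1=\mathbf{mdd}(\rho)=m$. Then for every $n\ge 0$, the number of $\rho$-minimal inversion sequences of length $n+k$ is $|\mathcal A_{n,m}|$. -/

import Mathlib

namespace InvSeq

/-- Inversion sequences of length `n`. With positions numbered from `0`, the condition
`σ_i ∈ {0, …, i - 1}` (positions numbered from `1`) reads `σ i ≤ i`. -/
def IsInversionSeq {n : ℕ} (σ : Fin n → ℕ) : Prop :=
  ∀ i : Fin n, σ i ≤ (i : ℕ)

/-- Cayley permutations of length `n`, with values starting at `0`: the set of values is exactly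
`{0, …, max ρ}` (which is empty for the empty sequence). -/
def IsCayleyPerm {n : ℕ} (ρ : Fin n → ℕ) : Prop :=
  Set.range ρ = {v : ℕ | ∃ i : Fin n, v ≤ ρ i}

/-- `Contains τ σ` (written `τ ≼ σ`): some subsequence of `σ` has its entries in the same relative
order as the entries of `τ`. Entries of equal value in `τ` correspond to entries of equal value in
`σ`, since the equivalence below is required for `(i, j)` and for `(j, i)`. -/
def Contains {l n : ℕ} (τ : Fin l → ℕ) (σ : Fin n → ℕ) : Prop :=
  ∃ f : Fin l ↪o Fin n, ∀ i j : Fin l, τ i < τ j ↔ σ (f i) < σ (f j)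

/-- The maximum diagonal difference `max_i (σ_i - i + 1)` (positions `i` numbered from `1`) of a
nonempty sequence. -/
def mdd {k : ℕ} [NeZero k] (σ : Fin k → ℕ) : ℤ :=
  Finset.univ.sup' Finset.univ_nonempty (fun i : Fin k => (σ i : ℤ) - ((i : ℕ) : ℤ))

/-- Membership in the set of inversion sequences, of any length, that are Cayley permutations and
contain the pattern `ρ`. -/
def MemIP {k l : ℕ} (ρ : Fin k → ℕ) (σ : Fin l → ℕ) : Prop :=
  IsInversionSeq σ ∧ IsCayleyPerm σ ∧ Contains ρ σ

/-- `σ` is a `ρ`-minimal inversion sequence: a minimal element, for pattern containment, of the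
set of all inversion sequences (of all lengths) that are Cayley permutations and contain `ρ`. -/
def IsMinimalFor {k l : ℕ} (ρ : Fin k → ℕ) (σ : Fin l → ℕ) : Prop :=
  MemIP ρ σ ∧ ∀ (p : ℕ) (τ : Fin p → ℕ), MemIP ρ τ → Contains τ σ → Contains σ τ

/-- The two colours. -/
inductive Colour : Type
  | blue : Colour
  | red : Colour

/-- The set `𝒜_{n,m}` of coloured inversion sequences `(α, c)` of length `n`: here `c` assigns a
colour to each value in `{0, …, n - 1}`, whether or not the value occurs in `α`; there are `m` blue
values and `n - m` red values, and each red value occurs at least twice in `α`.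
(If `n < m`, there cannot be `m` blue values, so the set is empty.) -/
def colouredSeqs (n m : ℕ) : Set ((Fin n → ℕ) × (Fin n → Colour)) :=
  {x | IsInversionSeq x.1 ∧
    {v : Fin n | x.2 v = Colour.blue}.ncard = m ∧
    {v : Fin n | x.2 v = Colour.red}.ncard = n - m ∧
    ∀ v : Fin n, x.2 v = Colour.red → 2 ≤ {i : Fin n | x.1 i = (v : ℕ)}.ncard}

end InvSeq

namespace InvSeq

open Finset

/-! Number positions from 0. The minimal sequences are exactly the reduced ones (`IsReduced`), and
these are encoded by coloured prefixes.

Minimal implies reduced: in a sequence containing `ρ`, entries between a suitable initial segment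
and an occurrence of `ρ` can be deleted so that the occurrence starts on the diagonal, and anything
after its first entry and outside it is deleted too; since `ρ j ≤ ρ 0 + j`, the standardization is
still an inversion sequence. A small value outside the occurrence that appears only once can be
deleted as well (`isReduced_of_irreducible`).

Reduced implies minimal: no reduced sequence contains a shorter reduced one (`IsReduced.length_eq`).
The number of distinct values of a reduced sequence exceeds `n` by a constant depending only on `ρ`,
so each deleted entry would have to be the only carrier of its value, which `twice` forbids in the
prefix.

Bijection: keep the prefix and colour blue the values below `n` used by the suffix. The suffix is
recovered because its entries are the `ρ j`-th elements (counting from 0) of the set of blue values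
and values at least `n`. -/

/-! ### Order-isomorphic sequences and pattern containment -/

lemma card_image_le_of_factors {ι : Type*} {a b : ι → ℕ} (h : ∀ i j, a i = a j → b i = b j)
    (T : Finset ι) : #(T.image b) ≤ #(T.image a) := by
  have : T.image b = (T.image a).image (Function.extend a b 0) := by
    rw [image_image]
    refine image_congr fun i _ => ?_
    exact (Function.FactorsThrough.extend_apply (fun i j hij => h i j hij) 0 i).symm
  rw [this]
  exact card_image_le

lemma eq_iff_of_lt_iff {ι : Type*} {a b : ι → ℕ} (h : ∀ i j, a i < a j ↔ b i < b j) (i j : ι) :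
    a i = a j ↔ b i = b j := by
  have := h i j
  have := h j i
  omega

lemma card_image_of_lt_iff {ι : Type*} {a b : ι → ℕ} (h : ∀ i j, a i < a j ↔ b i < b j)
    (T : Finset ι) : #(T.image b) = #(T.image a) :=
  le_antisymm (card_image_le_of_factors (fun i j => (eq_iff_of_lt_iff h i j).1) T)
    (card_image_le_of_factors (fun i j => (eq_iff_of_lt_iff h i j).2) T)

lemma IsCayleyPerm.exists_eq {n : ℕ} {ρ : Fin n → ℕ} (h : IsCayleyPerm ρ) {v : ℕ} {i : Fin n}
    (hv : v ≤ ρ i) : ∃ j, ρ j = v := by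
  have : v ∈ Set.range ρ := by
    rw [h]
    exact ⟨i, hv⟩
  exact this

lemma isCayleyPerm_of_exists {n : ℕ} {ρ : Fin n → ℕ} (h : ∀ i, ∀ v ≤ ρ i, ∃ j, ρ j = v) :
    IsCayleyPerm ρ := by
  ext v
  constructor
  · rintro ⟨j, rfl⟩
    exact ⟨j, le_rfl⟩
  · rintro ⟨i, hi⟩
    exact h i v hi

/-- An entry of a Cayley permutation is the number of smaller values in any sequence that is
order-isomorphic to it. -/
lemma IsCayleyPerm.count_eq {k : ℕ} {ρ s : Fin k → ℕ} (hρ : IsCayleyPerm ρ)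
    (h : ∀ i j, ρ i < ρ j ↔ s i < s j) (j : Fin k) :
    Nat.count (· ∈ univ.image s) (s j) = ρ j := by
  rw [Nat.count_eq_card_filter_range]
  have h1 : {x ∈ range (s j) | x ∈ univ.image s} = image s {i | ρ i < ρ j} := by
    ext v
    simp only [mem_filter, mem_range, mem_image, mem_univ, true_and]
    constructor
    · rintro ⟨hv, i, rfl⟩
      exact ⟨i, (h i j).2 hv, rfl⟩
    · rintro ⟨i, hi, rfl⟩
      exact ⟨(h i j).1 hi, i, rfl⟩
  have h2 : image ρ {i | ρ i < ρ j} = range (ρ j) := by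
    ext v
    simp only [mem_filter, mem_range, mem_image, mem_univ, true_and]
    constructor
    · rintro ⟨i, hi, rfl⟩
      exact hi
    · intro hv
      obtain ⟨i, rfl⟩ := hρ.exists_eq hv.le
      exact ⟨i, hv, rfl⟩
  rw [h1, card_image_of_lt_iff h, h2, card_range]

lemma Contains.trans {a b c : ℕ} {σ : Fin a → ℕ} {τ : Fin b → ℕ} {υ : Fin c → ℕ}
    (h : Contains σ τ) (h' : Contains τ υ) : Contains σ υ := by
  obtain ⟨f, hf⟩ := h
  obtain ⟨g, hg⟩ := h'
  exact ⟨f.trans g, fun i j => (hf i j).trans (hg _ _)⟩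

lemma Contains.length_le {a b : ℕ} {σ : Fin a → ℕ} {τ : Fin b → ℕ} (h : Contains σ τ) :
    a ≤ b := by
  obtain ⟨f, -⟩ := h
  simpa using Fintype.card_le_of_embedding f.toEmbedding

/-- The only order embedding of `Fin a` into itself is the identity. -/
lemma Contains.lt_iff {a : ℕ} {σ τ : Fin a → ℕ} (h : Contains σ τ) (i j : Fin a) :
    σ i < σ j ↔ τ i < τ j := by
  obtain ⟨f, hf⟩ := h
  have : ∀ i, f i = i := fun i => by
    have h1 : (OrderIso.ofRelIsoLT (RelIso.ofSurjective f.ltEmbedding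
      (Finite.surjective_of_injective f.injective))) = OrderIso.refl (Fin a) :=
        Subsingleton.elim _ _
    exact DFunLike.congr_fun h1 i
  simpa [this] using hf i j

lemma Contains.symm_of_length_eq {a : ℕ} {σ τ : Fin a → ℕ} (h : Contains σ τ) : Contains τ σ :=
  ⟨RelEmbedding.refl _, fun i j => (h.lt_iff i j).symm⟩

lemma eq_of_contains {a : ℕ} {σ τ : Fin a → ℕ} (hσ : IsCayleyPerm σ) (hτ : IsCayleyPerm τ)
    (h : Contains σ τ) : σ = τ := by
  ext j
  rw [← hσ.count_eq h.lt_iff j, hτ.count_eq (fun _ _ => Iff.rfl) j]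

/-! ### Standardized subsequences -/

/-- The Cayley permutation order-isomorphic to the subsequence of `σ` at the positions in `S`. -/
def restrict {N : ℕ} (σ : Fin N → ℕ) (S : Finset (Fin N)) (i : Fin #S) : ℕ :=
  Nat.count (· ∈ S.image σ) (σ (S.orderEmbOfFin rfl i))

lemma restrict_lt_iff {N : ℕ} (σ : Fin N → ℕ) (S : Finset (Fin N)) (i j : Fin #S) :
    restrict σ S i < restrict σ S j ↔
      σ (S.orderEmbOfFin rfl i) < σ (S.orderEmbOfFin rfl j) := by
  constructor
  · intro h
    by_contra! hle
    exact absurd h (Nat.count_monotone _ hle).not_gt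
  · exact fun h => Nat.count_strict_mono (mem_image_of_mem _ (S.orderEmbOfFin_mem rfl i)) h

lemma contains_restrict {N : ℕ} (σ : Fin N → ℕ) (S : Finset (Fin N)) :
    Contains (restrict σ S) σ :=
  ⟨S.orderEmbOfFin rfl, restrict_lt_iff σ S⟩

lemma exists_orderEmbOfFin_eq {N : ℕ} {S : Finset (Fin N)} {x : Fin N} (hx : x ∈ S) :
    ∃ i : Fin #S, S.orderEmbOfFin rfl i = x := by
  have : x ∈ Set.range (S.orderEmbOfFin rfl) := by
    rw [range_orderEmbOfFin]
    exact hx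
  exact this

lemma isCayleyPerm_restrict {N : ℕ} (σ : Fin N → ℕ) (S : Finset (Fin N)) :
    IsCayleyPerm (restrict σ S) := by
  refine isCayleyPerm_of_exists fun i v hv => ?_
  rcases hv.eq_or_lt with rfl | hv
  · exact ⟨i, rfl⟩
  have hlt := Nat.nth_lt_of_lt_count hv
  have hcard : ∀ hf : (Set.ofPred (· ∈ S.image σ)).Finite, v < #hf.toFinset := by
    intro hf
    exact hv.trans_le (Nat.count_le_card hf _)
  have hmem : Nat.nth (· ∈ S.image σ) v ∈ S.image σ := Nat.nth_mem v hcard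
  obtain ⟨x, hx, hxv⟩ := mem_image.1 hmem
  obtain ⟨j, rfl⟩ := exists_orderEmbOfFin_eq hx
  refine ⟨j, ?_⟩
  rw [restrict, hxv, Nat.count_nth hcard]

lemma contains_restrict_of_subset {N k : ℕ} {σ : Fin N → ℕ} {S : Finset (Fin N)}
    {ρ : Fin k → ℕ} {f : Fin k ↪o Fin N} (hf : ∀ i j, ρ i < ρ j ↔ σ (f i) < σ (f j))
    (hS : ∀ i, f i ∈ S) : Contains ρ (restrict σ S) := by
  choose g hg using fun i => exists_orderEmbOfFin_eq (hS i)
  refine ⟨OrderEmbedding.ofStrictMono g fun i j hij => ?_, fun i j => ?_⟩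
  · rw [← (S.orderEmbOfFin rfl).lt_iff_lt, hg, hg]
    exact f.strictMono hij
  · change ρ i < ρ j ↔ restrict σ S (g i) < restrict σ S (g j)
    rw [hf, restrict_lt_iff, hg, hg]

lemma isInversionSeq_restrict {N : ℕ} {σ : Fin N → ℕ} {S : Finset (Fin N)}
    (h : ∀ x ∈ S, Nat.count (· ∈ S.image σ) (σ x) ≤ #{y ∈ S | y < x}) :
    IsInversionSeq (restrict σ S) := by
  intro i
  refine (h _ (S.orderEmbOfFin_mem rfl i)).trans ?_
  have : {y ∈ S | y < S.orderEmbOfFin rfl i} ⊆ (Iio i).image (S.orderEmbOfFin rfl) := by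
    intro y hy
    obtain ⟨hyS, hlt⟩ := mem_filter.1 hy
    obtain ⟨j, rfl⟩ := exists_orderEmbOfFin_eq hyS
    exact mem_image_of_mem _ (mem_Iio.2 ((S.orderEmbOfFin rfl).lt_iff_lt.1 hlt))
  exact (card_le_card this).trans (card_image_le.trans (by simp))

lemma count_add_count_le {p q : ℕ → Prop} [DecidablePred p] [DecidablePred q] {a b : ℕ}
    (hab : a ≤ b) (h : ∀ v, a ≤ v → v < b → p v → q v) :
    Nat.count p b + Nat.count q a ≤ Nat.count q b + Nat.count p a := by
  induction b, hab using Nat.le_induction with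
  | base => omega
  | succ b hb ih =>
    have := ih fun v h1 h2 => h v h1 (by omega)
    have := h b hb (by omega)
    rw [Nat.count_succ, Nat.count_succ]
    split_ifs <;> first | omega | tauto

/-! ### Deleting entries to reach a reduced sequence -/

/-- The normal form of the inversion sequences that are minimal for `ρ`: the last `k` entries are
an occurrence of `ρ` starting on the diagonal, and smaller values not used by this occurrence
appear at least twice before it. -/
structure IsReduced {k n : ℕ} [NeZero k] (ρ : Fin k → ℕ) (σ : Fin (n + k) → ℕ) : Prop where
  inv : IsInversionSeq σ
  cayley : IsCayleyPerm σ
  occ : ∀ i j, ρ i < ρ j ↔ σ (Fin.natAdd n i) < σ (Fin.natAdd n j)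
  first : σ (Fin.natAdd n 0) = n
  twice : ∀ v < n, (∀ j, σ (Fin.natAdd n j) ≠ v) →
    ∃ i i' : Fin n, i ≠ i' ∧ σ (Fin.castAdd k i) = v ∧ σ (Fin.castAdd k i') = v

lemma sub_le_of_mdd {k m : ℕ} [NeZero k] {ρ : Fin k → ℕ} (hmdd : mdd ρ = (m : ℤ)) (j : Fin k) :
    ρ j ≤ m + j := by
  have : (ρ j : ℤ) - ((j : ℕ) : ℤ) ≤ mdd ρ :=
    le_sup' (fun i : Fin k => (ρ i : ℤ) - ((i : ℕ) : ℤ)) (mem_univ j)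
  omega

/-- The positions before `q` together with those of an occurrence of a pattern. -/
def initialPositions {k N : ℕ} (f : Fin k ↪o Fin N) (q : ℕ) : Finset (Fin N) :=
  univ.filter (fun x => (x : ℕ) < q) ∪ univ.image f

lemma mem_initialPositions {k N : ℕ} {f : Fin k ↪o Fin N} {q : ℕ} {x : Fin N} :
    x ∈ initialPositions f q ↔ (x : ℕ) < q ∨ ∃ j, f j = x := by
  simp [initialPositions]

lemma card_initialPositions_lt {k N : ℕ} [NeZero k] {f : Fin k ↪o Fin N} {q : ℕ}
    (hq : q ≤ f 0) (j : Fin k) : #{y ∈ initialPositions f q | y < f j} = q + j := by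
  have h1 : {y ∈ initialPositions f q | y < f j} =
      Iio (⟨q, hq.trans_lt (f 0).2⟩ : Fin N) ∪ (Iio j).image f := by
    ext y
    simp only [mem_filter, mem_initialPositions, mem_union, mem_Iio, mem_image, Fin.lt_def]
    constructor
    · rintro ⟨h | ⟨i, rfl⟩, hj⟩
      · exact Or.inl h
      · exact Or.inr ⟨i, f.lt_iff_lt.1 hj, rfl⟩
    · rintro (h | ⟨i, hi, rfl⟩)
      · have : f 0 ≤ f j := f.monotone (Fin.zero_le _)
        exact ⟨Or.inl h, by rw [Fin.le_def] at this; omega⟩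
      · exact ⟨Or.inr ⟨i, rfl⟩, f.lt_iff_lt.2 hi⟩
  rw [h1, card_union_of_disjoint, card_image_of_injective _ f.injective, Fin.card_Iio,
    Fin.card_Iio]
  rw [disjoint_left]
  intro y hy hy'
  obtain ⟨i, -, rfl⟩ := mem_image.1 hy'
  have : f 0 ≤ f i := f.monotone (Fin.zero_le _)
  rw [mem_Iio, Fin.lt_def] at hy
  rw [Fin.le_def] at this
  simp only at hy
  omega

/-- Among the initial segments ending before the occurrence `f`, one has as many entries as there
are values below the first entry of `f`. -/
lemma exists_initialPositions {k N : ℕ} [NeZero k] {σ : Fin N → ℕ} (hσ : IsInversionSeq σ)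
    (f : Fin k ↪o Fin N) :
    ∃ q ≤ (f 0 : ℕ), Nat.count (· ∈ (initialPositions f q).image σ) (σ (f 0)) = q := by
  have hex : ∃ q, Nat.count (· ∈ (initialPositions f q).image σ) (σ (f 0)) ≤ q :=
    ⟨f 0, (Nat.count_le _).trans (hσ _)⟩
  classical
  have hmin : Nat.find hex ≤ f 0 := Nat.find_min' hex ((Nat.count_le _).trans (hσ _))
  refine ⟨Nat.find hex, hmin, le_antisymm (Nat.find_spec hex) ?_⟩
  rcases Nat.eq_zero_or_pos (Nat.find hex) with h0 | h0
  · rw [h0]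
    exact Nat.zero_le _
  -- The count is monotone in the segment length and already exceeds `q - 1` at `q - 1`, so at the
  -- least `q` it cannot be below `q`.
  · have h1 := Nat.find_min hex (Nat.sub_one_lt h0.ne')
    have h2 : Nat.count (· ∈ (initialPositions f (Nat.find hex - 1)).image σ) (σ (f 0)) ≤
        Nat.count (· ∈ (initialPositions f (Nat.find hex)).image σ) (σ (f 0)) := by
      refine Nat.count_mono_left fun v _ hv => ?_
      refine image_subset_image (fun x hx => ?_) hv
      rw [mem_initialPositions] at hx ⊢
      exact hx.imp_left fun h => by omega
    omega

/-- Standardizing only lowers entries, and those before `q` keep their positions. The first entry of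
the occurrence lands on the diagonal at `q`. Initial entries have values below `q`, so above `σ (f
0)` only values of the occurrence count: entry `j` rises above `q` by at most `ρ j - m ≤ j`. -/
lemma count_initialPositions_le {k m N : ℕ} [NeZero k] {ρ : Fin k → ℕ} (hρ : IsCayleyPerm ρ)
    (hfirst : ρ 0 = m) (hmdd : mdd ρ = (m : ℤ)) {σ : Fin N → ℕ} (hσ : IsInversionSeq σ)
    {f : Fin k ↪o Fin N} (hf : ∀ i j, ρ i < ρ j ↔ σ (f i) < σ (f j)) {q : ℕ}
    (hq : q ≤ (f 0 : ℕ))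
    (hcount : Nat.count (· ∈ (initialPositions f q).image σ) (σ (f 0)) = q) :
    ∀ x ∈ initialPositions f q, Nat.count (· ∈ (initialPositions f q).image σ) (σ x) ≤
      #{y ∈ initialPositions f q | y < x} := by
  have hq' : q ≤ σ (f 0) := hcount.symm.le.trans (Nat.count_le _)
  intro x hx
  rcases mem_initialPositions.1 hx with hx | ⟨j, rfl⟩
  · have : Iio x ⊆ {y ∈ initialPositions f q | y < x} := fun y hy => by
      rw [mem_Iio] at hy
      exact mem_filter.2 ⟨mem_initialPositions.2 (Or.inl (lt_trans hy hx)), hy⟩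
    calc _ ≤ σ x := (Nat.count_le _)
      _ ≤ x := hσ x
      _ = #(Iio x) := by simp
      _ ≤ _ := card_le_card this
  · rw [card_initialPositions_lt hq]
    rcases le_total (σ (f j)) (σ (f 0)) with hle | hle
    · have := Nat.count_monotone (· ∈ (initialPositions f q).image σ) hle
      omega
    · have h1 := count_add_count_le (p := (· ∈ (initialPositions f q).image σ))
        (q := (· ∈ univ.image (σ ∘ f))) hle fun v hv _ hmem => by
          obtain ⟨y, hy, rfl⟩ := mem_image.1 hmem
          rcases mem_initialPositions.1 hy with hy | ⟨i, rfl⟩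
          · have := hσ y
            omega
          · exact mem_image_of_mem (σ ∘ f) (mem_univ i)
      have h2 := hρ.count_eq (s := σ ∘ f) hf j
      have h3 := hρ.count_eq (s := σ ∘ f) hf 0
      have h4 := sub_le_of_mdd hmdd j
      simp only [Function.comp_apply] at h2 h3
      omega

/-- A sequence none of whose proper subsequences standardizes to an inversion sequence containing
`ρ` is reduced. -/
lemma isReduced_of_irreducible {k m N : ℕ} [NeZero k] {ρ : Fin k → ℕ} (hρ : IsCayleyPerm ρ)
    (hfirst : ρ 0 = m) (hmdd : mdd ρ = (m : ℤ)) {σ : Fin N → ℕ} (hσ : MemIP ρ σ)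
    (hirr : ∀ S : Finset (Fin N), MemIP ρ (restrict σ S) → S = univ) :
    ∃ n, ∃ h : n + k = N, IsReduced ρ (σ ∘ Fin.cast h) := by
  obtain ⟨hinv, hcay, f, hf⟩ := hσ
  obtain ⟨q, hq, hcount⟩ := exists_initialPositions hinv f
  have huniv : initialPositions f q = univ := hirr _
    ⟨isInversionSeq_restrict (count_initialPositions_le hρ hfirst hmdd hinv hf hq hcount),
      isCayleyPerm_restrict _ _,
      contains_restrict_of_subset hf fun i => mem_initialPositions.2 (Or.inr ⟨i, rfl⟩)⟩
  have hpos : ∀ j, (f j : ℕ) = q + j := by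
    intro j
    rw [← card_initialPositions_lt hq, huniv, filter_gt_eq_Iio, Fin.card_Iio]
  -- Nothing outside the initial segment and the occurrence remains, so the occurrence is a suffix.
  have hN : q + k = N := by
    have hk := NeZero.pos k
    have hlast := hpos ⟨k - 1, by omega⟩
    have hlt := (f ⟨k - 1, by omega⟩).2
    have hcard : N ≤ #(Iio (⟨q, hq.trans_lt (f 0).2⟩ : Fin N)) + k := by
      calc N = #(initialPositions f q) := by rw [huniv, card_univ, Fintype.card_fin]
        _ ≤ _ := card_union_le _ _
        _ ≤ _ := Nat.add_le_add (card_le_card fun x hx => mem_Iio.2 (mem_filter.1 hx).2)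
          (card_image_le.trans (by simp))
    rw [Fin.card_Iio] at hcard
    simp only at hlast hcard
    omega
  subst hN
  have hpos' : ∀ j, f j = Fin.natAdd q j := fun j => Fin.ext (hpos j)
  have hfirst' : σ (Fin.natAdd q 0) = q := by
    rw [huniv, hcay.count_eq (fun _ _ => Iff.rfl)] at hcount
    rw [← hpos', hcount]
  refine ⟨q, rfl, hinv, hcay, fun i j => ?_, hfirst', fun v hv hne => ?_⟩
  · simpa [hpos'] using hf i j
  by_contra! hcon
  obtain ⟨x, hx⟩ := hcay.exists_eq (hv.le.trans hfirst'.symm.le)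
  have hsuffix : ∀ j, Fin.natAdd q j ≠ x := fun j hj => hne j (by simpa [hj] using hx)
  have huniq : ∀ y, σ y = v → y = x := by
    intro y hy
    induction y using Fin.addCases with
    | right j => exact absurd hy (hne j)
    | left i =>
      induction x using Fin.addCases with
      | right j => exact absurd rfl (hsuffix j)
      | left i' =>
        by_contra hii
        exact hcon i i' (fun h => hii (by rw [h])) hy hx
  have hmem : MemIP ρ (restrict σ (univ.erase x)) := by
    refine ⟨isInversionSeq_restrict fun y hy => ?_, isCayleyPerm_restrict _ _,
      contains_restrict_of_subset hf fun i => ?_⟩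
    · have hyx : y ≠ x := (mem_erase.1 hy).1
      have hyv : σ y ≠ v := fun h => hyx (huniq y h)
      have hcard : #{z ∈ univ.erase x | z < y} = #((Iio y).erase x) := by
        congr 1
        ext z
        simp
      have hxle := hinv x
      have hyle := hinv y
      rw [hcard]
      -- Erasing `x` lowers larger values by one, matching a possible shift in position. A smaller
      -- value to the right of `x` has slack: `σ y < σ x ≤ x < y`.
      rcases lt_or_gt_of_ne hyv with hlt | hlt
      · refine (Nat.count_le _).trans ?_
        rcases lt_or_gt_of_ne hyx with h | h
        · rw [erase_eq_of_notMem (by simpa using h.le), Fin.card_Iio]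
          exact hyle
        · rw [card_erase_of_mem (by simpa using h), Fin.card_Iio]
          rw [Fin.lt_def] at h
          omega
      · have h1 : Nat.count (· ∈ (univ.erase x).image σ) (σ y) ≤ σ y - 1 := by
          rw [Nat.count_eq_card_filter_range]
          have : {z ∈ range (σ y) | z ∈ (univ.erase x).image σ} ⊆ (range (σ y)).erase v := by
            intro z hz
            obtain ⟨hz, hz'⟩ := mem_filter.1 hz
            obtain ⟨w, hw, rfl⟩ := mem_image.1 hz'
            exact mem_erase.2 ⟨fun h => (mem_erase.1 hw).1 (huniq w h), hz⟩
          refine (card_le_card this).trans ?_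
          rw [card_erase_of_mem (by simpa using hlt), card_range]
        have h2 := pred_card_le_card_erase (s := Iio y) (a := x)
        rw [Fin.card_Iio] at h2
        omega
    · rw [hpos']
      exact mem_erase.2 ⟨hsuffix i, mem_univ _⟩
  have := hirr _ hmem
  exact (mem_erase.1 (this ▸ mem_univ x)).1 rfl

/-- Every inversion sequence that is a Cayley permutation containing `ρ` contains a reduced one. -/
lemma exists_isReduced_contains {k m N : ℕ} [NeZero k] {ρ : Fin k → ℕ} (hρ : IsCayleyPerm ρ)
    (hfirst : ρ 0 = m) (hmdd : mdd ρ = (m : ℤ)) {σ : Fin N → ℕ} (hσ : MemIP ρ σ) :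
    ∃ n, ∃ τ : Fin (n + k) → ℕ, IsReduced ρ τ ∧ Contains τ σ := by
  induction N using Nat.strong_induction_on with
  | _ N ih =>
    by_cases hirr : ∀ S : Finset (Fin N), MemIP ρ (restrict σ S) → S = univ
    · obtain ⟨n, rfl, h⟩ := isReduced_of_irreducible hρ hfirst hmdd hσ hirr
      exact ⟨n, _, h, RelEmbedding.refl _, fun i j => Iff.rfl⟩
    · push Not at hirr
      obtain ⟨S, hS, hne⟩ := hirr
      have hlt : #S < N := by
        simpa using (card_lt_iff_ne_univ S).2 hne
      obtain ⟨n, τ, hτ, hc⟩ := ih _ hlt hS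
      exact ⟨n, τ, hτ, hc.trans (contains_restrict σ S)⟩

/-! ### Containment between reduced sequences -/

variable {k m n : ℕ} [NeZero k] {ρ : Fin k → ℕ}

lemma IsReduced.memIP {σ : Fin (n + k) → ℕ} (h : IsReduced ρ σ) : MemIP ρ σ :=
  ⟨h.inv, h.cayley, Fin.natAddOrderEmb n, h.occ⟩

lemma IsReduced.count_suffix (hρ : IsCayleyPerm ρ) {σ : Fin (n + k) → ℕ} (h : IsReduced ρ σ)
    (j : Fin k) :
    Nat.count (· ∈ univ.image fun i => σ (Fin.natAdd n i)) (σ (Fin.natAdd n j)) = ρ j :=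
  hρ.count_eq (s := fun i => σ (Fin.natAdd n i)) h.occ j

lemma IsReduced.mem_suffix_of_le {σ : Fin (n + k) → ℕ} (h : IsReduced ρ σ) {x : Fin (n + k)}
    (hx : n ≤ σ x) : ∃ j, σ (Fin.natAdd n j) = σ x := by
  induction x using Fin.addCases with
  | right j => exact ⟨j, rfl⟩
  | left i =>
    have := h.inv (Fin.castAdd k i)
    rw [Fin.val_castAdd] at this
    omega

/-- The values are those below `n` and those of the suffix. The overlap has `ρ 0` elements, as the
suffix starts with the value `n`. -/
lemma IsReduced.card_image (hρ : IsCayleyPerm ρ) {σ : Fin (n + k) → ℕ} (h : IsReduced ρ σ) :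
    #(univ.image σ) + ρ 0 = #(univ.image ρ) + n := by
  have h1 : univ.image σ = (univ.image fun j => σ (Fin.natAdd n j)) ∪ range n := by
    ext v
    simp only [mem_image, mem_univ, true_and, mem_union, mem_range]
    constructor
    · rintro ⟨x, rfl⟩
      rcases lt_or_ge (σ x) n with hx | hx
      · exact Or.inr hx
      · exact Or.inl (h.mem_suffix_of_le hx)
    · rintro (⟨j, rfl⟩ | hv)
      · exact ⟨_, rfl⟩
      · exact h.cayley.exists_eq (hv.le.trans h.first.symm.le)
  have h2 := card_union_add_card_inter (univ.image fun j => σ (Fin.natAdd n j)) (range n)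
  have h3 := h.count_suffix hρ 0
  have h4 : #(univ.image fun j => σ (Fin.natAdd n j)) = #(univ.image ρ) :=
    card_image_of_lt_iff h.occ univ
  rw [h.first, Nat.count_eq_card_filter_range, filter_mem_eq_inter, inter_comm] at h3
  rw [h1, ← h3, h2, h4, card_range]

/-- The entries of a reduced sequence that are missing from a reduced subsequence have values that
occur only once. -/
lemma IsReduced.eq_of_notMem_range (hρ : IsCayleyPerm ρ) {n' : ℕ} {τ : Fin (n' + k) → ℕ}
    {σ : Fin (n + k) → ℕ} (hτ : IsReduced ρ τ) (hσ : IsReduced ρ σ)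
    {h : Fin (n' + k) ↪o Fin (n + k)} (hh : ∀ i j, τ i < τ j ↔ σ (h i) < σ (h j))
    {x y : Fin (n + k)} (hx : x ∉ univ.image h) (hxy : σ y = σ x) : y = x := by
  set K := univ.image h with hK
  have hcK : #K = n' + k := by
    rw [hK, card_image_of_injective _ h.injective, card_univ, Fintype.card_fin]
  have hcD : #K + #Kᶜ = n + k := by
    rw [card_add_card_compl, Fintype.card_fin]
  have h1 : univ.image σ = K.image σ ∪ Kᶜ.image σ := by
    rw [← image_union, union_compl]
  have h2 : #(K.image σ) = #(univ.image τ) := by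
    rw [hK, image_image]
    exact card_image_of_lt_iff hh univ
  have h3 := hτ.card_image hρ
  have h4 := hσ.card_image hρ
  have h5 := card_union_add_card_inter (K.image σ) (Kᶜ.image σ)
  have h6 : #(Kᶜ.image σ) ≤ #Kᶜ := card_image_le
  rw [← h1] at h5
  -- By `card_image`, dropping `n - n'` entries loses `n - n'` values, so every inequality is tight.
  have hinj : Set.InjOn σ (Kᶜ : Finset (Fin (n + k))) := card_image_iff.1 (by omega)
  have hdisj : K.image σ ∩ Kᶜ.image σ = ∅ := card_eq_zero.1 (by omega)
  have hx' : x ∈ Kᶜ := mem_compl.2 hx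
  by_cases hy : y ∈ K
  · have : σ x ∈ K.image σ ∩ Kᶜ.image σ :=
      mem_inter.2 ⟨hxy ▸ mem_image_of_mem _ hy, mem_image_of_mem _ hx'⟩
    rw [hdisj] at this
    exact absurd this (notMem_empty _)
  · exact hinj (mem_compl.2 hy) hx' hxy

lemma IsReduced.castAdd_mem_range (hρ : IsCayleyPerm ρ) {n' : ℕ} {τ : Fin (n' + k) → ℕ}
    {σ : Fin (n + k) → ℕ} (hτ : IsReduced ρ τ) (hσ : IsReduced ρ σ)
    {h : Fin (n' + k) ↪o Fin (n + k)} (hh : ∀ i j, τ i < τ j ↔ σ (h i) < σ (h j)) (i : Fin n) :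
    Fin.castAdd k i ∈ univ.image h := by
  by_contra hi
  have huniq := fun y => hτ.eq_of_notMem_range hρ hσ hh (y := y) hi
  have hlt : σ (Fin.castAdd k i) < n := (hσ.inv _).trans_lt i.2
  have hne : ∀ j, σ (Fin.natAdd n j) ≠ σ (Fin.castAdd k i) := fun j hj => by
    have := congrArg Fin.val (huniq _ hj)
    simp only [Fin.val_natAdd, Fin.val_castAdd] at this
    omega
  obtain ⟨a, b, hab, ha, hb⟩ := hσ.twice _ hlt hne
  exact hab (Fin.castAdd_injective n k ((huniq _ ha).trans (huniq _ hb).symm))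

/-- An increasing map that hits every prefix position cannot skip any of them. -/
lemma IsReduced.apply_eq_of_lt (hρ : IsCayleyPerm ρ) {n' : ℕ} {τ : Fin (n' + k) → ℕ}
    {σ : Fin (n + k) → ℕ} (hτ : IsReduced ρ τ) (hσ : IsReduced ρ σ)
    {h : Fin (n' + k) ↪o Fin (n + k)} (hh : ∀ i j, τ i < τ j ↔ σ (h i) < σ (h j))
    (i : ℕ) (hi : i < n' + k) (hin : i < n) : (h ⟨i, hi⟩ : ℕ) = i := by
  induction i using Nat.strong_induction_on with
  | _ i ih =>
    rcases lt_trichotomy (h ⟨i, hi⟩ : ℕ) i with hlt | heq | hgt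
    · have h1 := ih _ hlt (hlt.trans hi) (hlt.trans hin)
      have h2 := congrArg Fin.val (h.injective (Fin.ext h1))
      exact h2
    · exact heq
    · obtain ⟨j, -, hj⟩ := mem_image.1 (hτ.castAdd_mem_range hρ hσ hh ⟨i, hin⟩)
      have hj' : (h j : ℕ) = i := by rw [hj, Fin.val_castAdd]
      have hji : j < ⟨i, hi⟩ := by
        rw [← h.lt_iff_lt, Fin.lt_def, hj']
        exact hgt
      have h1 := ih j hji j.2 (lt_trans hji hin)
      have h2 : (j : ℕ) < i := hji
      rw [Fin.eta] at h1
      omega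

/-- If `n' < n`, position `n'` of `σ` holds the value `n'`. Counting values at positions from `n'`
on shows that this value is absent from the suffix and occurs only once in the prefix, contradicting
`twice`. -/
lemma IsReduced.length_eq (hρ : IsCayleyPerm ρ) {n' : ℕ} {τ : Fin (n' + k) → ℕ}
    {σ : Fin (n + k) → ℕ} (hτ : IsReduced ρ τ) (hσ : IsReduced ρ σ) (hc : Contains τ σ) :
    n' = n := by
  have hle := hc.length_le
  by_contra hne
  have hlt : n' < n := by omega
  obtain ⟨h, hh⟩ := hc
  have hfix : (h (Fin.natAdd n' 0) : ℕ) = n' :=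
    hτ.apply_eq_of_lt hρ hσ hh n' _ hlt
  -- At least `n'` smaller values occur in `σ ∘ h`, while the inversion bound at position `n'` gives
  -- the reverse inequality.
  have hval : σ (h (Fin.natAdd n' 0)) = n' := by
    have h1 := hτ.cayley.count_eq (s := σ ∘ h) hh (Fin.natAdd n' 0)
    rw [hτ.first] at h1
    have h2 := hσ.inv (h (Fin.natAdd n' 0))
    have h3 := h1.symm.le.trans (Nat.count_le _)
    simp only [Function.comp_apply] at h3
    omega
  set T := univ.image fun j => σ (Fin.natAdd n j) with hT
  set U := univ.image fun j => σ (h (Fin.natAdd n' j)) with hU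
  set K := univ.image h with hK
  set A : Finset (Fin (n + k)) := univ.filter (fun x => n' ≤ (x : ℕ) ∧ (x : ℕ) < n) with hA
  have hcT : #T = #(univ.image ρ) := card_image_of_lt_iff hσ.occ univ
  have hcU : #U = #(univ.image ρ) :=
    card_image_of_lt_iff (fun i j => (hτ.occ i j).trans (hh _ _)) univ
  have hcA : #A ≤ n - n' := by
    rw [← Nat.card_Ico]
    exact card_le_card_of_injOn Fin.val (fun x hx => by simpa [hA] using hx)
      Fin.val_injective.injOn
  have huniq : ∀ x ∈ Kᶜ, ∀ y, σ y = σ x → y = x := fun x hx y =>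
    hτ.eq_of_notMem_range hρ hσ hh (mem_compl.1 hx)
  have hcD : #(Kᶜ.image σ) = n - n' := by
    rw [card_image_of_injOn fun x hx y hy hxy => huniq y hy x hxy, card_compl, hK,
      card_image_of_injective _ h.injective, card_univ, Fintype.card_fin, Fintype.card_fin]
    omega
  have hdisj : Disjoint U (Kᶜ.image σ) := by
    rw [disjoint_left]
    intro v hv hv'
    obtain ⟨j, -, rfl⟩ := mem_image.1 hv
    obtain ⟨x, hx, hxv⟩ := mem_image.1 hv'
    have := huniq x hx _ hxv.symm
    exact mem_compl.1 hx (this ▸ mem_image_of_mem h (mem_univ _))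
  have hTA : ∀ x : Fin (n + k), n' ≤ (x : ℕ) → σ x ∈ T ∪ A.image σ := by
    intro x hx
    induction x using Fin.addCases with
    | right j => exact mem_union_left _ (mem_image_of_mem (fun j => σ (Fin.natAdd n j)) (mem_univ j))
    | left i => exact mem_union_right _ (mem_image_of_mem σ (mem_filter.2 ⟨mem_univ _, hx, i.2⟩))
  have hsub : U ∪ Kᶜ.image σ ⊆ T ∪ A.image σ := by
    refine union_subset (fun v hv => ?_) (fun v hv => ?_)
    · obtain ⟨j, -, rfl⟩ := mem_image.1 hv
      refine hTA _ (hfix.symm.le.trans (h.monotone ?_))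
      rw [Fin.natAdd_le_natAdd_iff]
      exact Fin.zero_le _
    · obtain ⟨x, hx, rfl⟩ := mem_image.1 hv
      refine hTA _ (hlt.le.trans ?_)
      by_contra! hxn
      exact mem_compl.1 hx (hτ.castAdd_mem_range hρ hσ hh ⟨x, hxn⟩)
  have h1 := card_le_card hsub
  rw [card_union_of_disjoint hdisj] at h1
  have h2 := card_union_add_card_inter T (A.image σ)
  have h3 : #(A.image σ) ≤ #A := card_image_le
  -- The left side of `hsub` has `#(univ.image ρ) + (n - n')` elements and the right side at most
  -- that many, so equality holds throughout.
  have hinj : Set.InjOn σ A := card_image_iff.1 (by omega)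
  have hinter : T ∩ A.image σ = ∅ := card_eq_zero.1 (by omega)
  have hmemA : n' ∈ A.image σ :=
    mem_image.2 ⟨_, mem_filter.2 ⟨mem_univ _, hfix.symm.le, hfix.trans_lt hlt⟩, hval⟩
  obtain ⟨a, b, hab, ha, hb⟩ := hσ.twice n' hlt fun j hj => by
    have : n' ∈ T ∩ A.image σ :=
      mem_inter.2 ⟨mem_image.2 ⟨j, mem_univ _, hj⟩, hmemA⟩
    rw [hinter] at this
    exact notMem_empty _ this
  -- In an inversion sequence the value `n'` cannot occur before position `n'`.
  have hmem : ∀ i : Fin n, σ (Fin.castAdd k i) = n' → Fin.castAdd k i ∈ A := fun i hi =>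
    mem_filter.2 ⟨mem_univ _, hi.symm.le.trans (hσ.inv _), i.2⟩
  exact hab (Fin.castAdd_injective n k (hinj (hmem a ha) (hmem b hb) (ha.trans hb.symm)))

lemma isMinimalFor_iff_isReduced (hρ : IsCayleyPerm ρ) (hfirst : ρ 0 = m)
    (hmdd : mdd ρ = (m : ℤ)) {σ : Fin (n + k) → ℕ} : IsMinimalFor ρ σ ↔ IsReduced ρ σ := by
  constructor
  · rintro ⟨hσ, hmin⟩
    obtain ⟨n', τ, hτ, hc⟩ := exists_isReduced_contains hρ hfirst hmdd hσ
    have h1 := hc.length_le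
    have h2 := (hmin _ τ hτ.memIP hc).length_le
    obtain rfl : n' = n := by omega
    rwa [← eq_of_contains hτ.cayley hσ.2.1 hc]
  · intro hσ
    refine ⟨hσ.memIP, fun p τ hτ hc => ?_⟩
    obtain ⟨n', υ, hυ, hc'⟩ := exists_isReduced_contains hρ hfirst hmdd hτ
    obtain rfl := hυ.length_eq hρ hσ (hc'.trans hc)
    obtain rfl := le_antisymm hc'.length_le hc.length_le
    exact hc.symm_of_length_eq

/-! ### Reduced sequences as coloured inversion sequences -/

/-- The prefix of length `n`, with the values coloured blue if the last `k` entries use them. -/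
noncomputable def toColoured (σ : Fin (n + k) → ℕ) : (Fin n → ℕ) × (Fin n → Colour) :=
  open Classical in
  (fun i => σ (Fin.castAdd k i),
    fun v => if ∃ j, σ (Fin.natAdd n j) = v then Colour.blue else Colour.red)

/-- The values available to the last `k` entries: the blue ones and those at least `n`. -/
def IsSuffixValue (c : Fin n → Colour) (v : ℕ) : Prop :=
  (∃ h : v < n, c ⟨v, h⟩ = Colour.blue) ∨ n ≤ v

lemma toColoured_blue_iff {l : ℕ} (σ : Fin (n + l) → ℕ) (v : Fin n) :
    (toColoured σ).2 v = Colour.blue ↔ ∃ j, σ (Fin.natAdd n j) = v := by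
  simp [toColoured]

lemma eq_red_iff (c : Colour) : c = Colour.red ↔ c ≠ Colour.blue := by
  cases c <;> simp

open Classical in
lemma ncard_blue (c : Fin n → Colour) :
    {v : Fin n | c v = Colour.blue}.ncard = Nat.count (IsSuffixValue c) n := by
  have : {v ∈ range n | IsSuffixValue c v} =
      (univ.filter fun v => c v = Colour.blue).map Fin.valEmbedding := by
    ext v
    rw [mem_filter, mem_map, mem_range]
    simp only [IsSuffixValue, mem_filter, mem_univ, true_and, Fin.valEmbedding_apply]
    constructor
    · rintro ⟨h, ⟨_, hc⟩ | h'⟩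
      · exact ⟨_, hc, rfl⟩
      · omega
    · rintro ⟨w, hw, rfl⟩
      exact ⟨w.2, Or.inl ⟨w.2, hw⟩⟩
  rw [Nat.count_eq_card_filter_range, this, card_map, ← Set.ncard_coe_finset]
  simp

lemma ncard_red (c : Fin n → Colour) :
    {v : Fin n | c v = Colour.red}.ncard = n - {v : Fin n | c v = Colour.blue}.ncard := by
  have h1 := Set.ncard_add_ncard_compl {v : Fin n | c v = Colour.blue}
  have h2 : {v : Fin n | c v = Colour.blue}ᶜ = {v : Fin n | c v = Colour.red} := by
    ext v
    simp [eq_red_iff]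
  rw [h2, Nat.card_fin] at h1
  omega

lemma infinite_isSuffixValue (c : Fin n → Colour) : (Set.ofPred (IsSuffixValue c)).Infinite :=
  (Set.Ici_infinite n).mono fun _ hv => Or.inr hv

open Classical in
lemma IsReduced.count_isSuffixValue (hρ : IsCayleyPerm ρ) {σ : Fin (n + k) → ℕ}
    (h : IsReduced ρ σ) (j : Fin k) :
    Nat.count (IsSuffixValue (toColoured σ).2) (σ (Fin.natAdd n j)) = ρ j := by
  have key : ∀ v < σ (Fin.natAdd n j), IsSuffixValue (toColoured σ).2 v ↔
      v ∈ univ.image fun i => σ (Fin.natAdd n i) := by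
    intro v hv
    simp only [IsSuffixValue, toColoured_blue_iff, mem_image, mem_univ, true_and]
    constructor
    · rintro (⟨_, hv⟩ | hv')
      · exact hv
      · obtain ⟨x, rfl⟩ := h.cayley.exists_eq hv.le
        exact h.mem_suffix_of_le hv'
    · intro hi
      rcases lt_or_ge v n with hvn | hvn
      · exact Or.inl ⟨hvn, hi⟩
      · exact Or.inr hvn
  rw [← h.count_suffix hρ j]
  exact le_antisymm (Nat.count_mono_left fun v hv => (key v hv).1)
    (Nat.count_mono_left fun v hv => (key v hv).2)

lemma IsReduced.natAdd_eq_nth (hρ : IsCayleyPerm ρ) {σ : Fin (n + k) → ℕ}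
    (h : IsReduced ρ σ) (j : Fin k) :
    σ (Fin.natAdd n j) = Nat.nth (IsSuffixValue (toColoured σ).2) (ρ j) := by
  classical
  rw [← h.count_isSuffixValue hρ j, Nat.nth_count]
  rcases lt_or_ge (σ (Fin.natAdd n j)) n with hn | hn
  · exact Or.inl ⟨hn, (toColoured_blue_iff _ _).2 ⟨j, rfl⟩⟩
  · exact Or.inr hn

lemma injOn_toColoured (hρ : IsCayleyPerm ρ) :
    Set.InjOn (toColoured (n := n)) {σ : Fin (n + k) → ℕ | IsReduced ρ σ} := by
  intro σ hσ σ' hσ' heq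
  ext x
  induction x using Fin.addCases with
  | left i => exact congrFun (congrArg Prod.fst heq) i
  | right j => rw [hσ.natAdd_eq_nth hρ, hσ'.natAdd_eq_nth hρ, heq]

lemma IsReduced.toColoured_mem (hρ : IsCayleyPerm ρ) (hfirst : ρ 0 = m)
    {σ : Fin (n + k) → ℕ} (h : IsReduced ρ σ) : toColoured σ ∈ colouredSeqs n m := by
  have hblue : {v : Fin n | (toColoured σ).2 v = Colour.blue}.ncard = m := by
    classical
    rw [ncard_blue, ← hfirst, ← h.count_isSuffixValue hρ 0, h.first]
  refine ⟨fun i => h.inv (Fin.castAdd k i), hblue, by rw [ncard_red, hblue], fun v hv => ?_⟩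
  rw [eq_red_iff, Ne, toColoured_blue_iff] at hv
  push Not at hv
  obtain ⟨a, b, hab, ha, hb⟩ := h.twice v v.2 hv
  exact (Set.one_lt_ncard_iff (Set.toFinite _)).2 ⟨a, b, ha, hb, hab⟩

lemma exists_isReduced_toColoured (hρ : IsCayleyPerm ρ) (hfirst : ρ 0 = m)
    (hmdd : mdd ρ = (m : ℤ)) {x : (Fin n → ℕ) × (Fin n → Colour)} (hx : x ∈ colouredSeqs n m) :
    ∃ σ : Fin (n + k) → ℕ, IsReduced ρ σ ∧ toColoured σ = x := by
  classical
  obtain ⟨α, c⟩ := x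
  obtain ⟨hα, hblue, -, hred⟩ := hx
  simp only at hα hblue hred
  set P := IsSuffixValue c with hP
  have hinf := infinite_isSuffixValue c
  have hcount : Nat.count P n = m := by rw [← ncard_blue, hblue]
  have hcount' : ∀ t, Nat.count P (n + t) = m + t := by
    intro t
    induction t with
    | zero => exact hcount
    | succ t ih =>
      have hPt : P (n + t) := Or.inr (Nat.le_add_right _ _)
      rw [← add_assoc, Nat.count_succ, ih, if_pos hPt]
      rfl
  have hnth : ∀ t, Nat.nth P (m + t) = n + t := fun t => by
    rw [← hcount', Nat.nth_count]
    exact Or.inr (Nat.le_add_right _ _)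
  set σ : Fin (n + k) → ℕ := Fin.append α fun j => Nat.nth P (ρ j) with hσ
  have hleft : ∀ i, σ (Fin.castAdd k i) = α i := fun i => Fin.append_left _ _ i
  have hright : ∀ j, σ (Fin.natAdd n j) = Nat.nth P (ρ j) := fun j => Fin.append_right _ _ j
  have hzero : σ (Fin.natAdd n 0) = n := by rw [hright, hfirst]; exact hnth 0
  -- `ρ` takes every value up to `ρ j`, so the suffix skips no available value below one of its
  -- entries. As the suffix contains `n`, it uses all blue values.
  have hsuffix : ∀ v, P v → ∀ j, v ≤ σ (Fin.natAdd n j) → ∃ i, σ (Fin.natAdd n i) = v := by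
    intro v hv j hvj
    have h1 := Nat.count_monotone P hvj
    rw [hright, Nat.count_nth_of_infinite hinf] at h1
    obtain ⟨i, hi⟩ := hρ.exists_eq h1
    exact ⟨i, by rw [hright, hi, Nat.nth_count hv]⟩
  have htwice : ∀ v (hv : v < n), c ⟨v, hv⟩ ≠ Colour.blue →
      ∃ i i' : Fin n, i ≠ i' ∧ σ (Fin.castAdd k i) = v ∧ σ (Fin.castAdd k i') = v := by
    intro v hv hc
    obtain ⟨a, b, ha, hb, hab⟩ := (Set.one_lt_ncard_iff (Set.toFinite _)).1
      (hred ⟨v, hv⟩ ((eq_red_iff _).2 hc))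
    exact ⟨a, b, hab, (hleft a).trans ha, (hleft b).trans hb⟩
  have hsmall : ∀ v < n, ∃ y, σ y = v := by
    intro v hv
    by_cases hc : c ⟨v, hv⟩ = Colour.blue
    · obtain ⟨i, hi⟩ := hsuffix v (Or.inl ⟨hv, hc⟩) 0 (hv.le.trans hzero.symm.le)
      exact ⟨_, hi⟩
    · obtain ⟨a, -, -, ha, -⟩ := htwice v hv hc
      exact ⟨_, ha⟩
  refine ⟨σ, ⟨?_, ?_, ?_, hzero, ?_⟩, ?_⟩
  · intro y
    induction y using Fin.addCases with
    | left i => rw [hleft]; exact hα i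
    | right j =>
      -- Since the `(m + j)`-th available value is `n + j`, the diagonal bound becomes `ρ j ≤ m +
      -- j`.
      rw [hright, Fin.val_natAdd, ← hnth]
      exact Nat.nth_monotone hinf (sub_le_of_mdd hmdd j)
  · refine isCayleyPerm_of_exists fun y v hv => ?_
    induction y using Fin.addCases with
    | left i =>
      rw [hleft] at hv
      exact hsmall v (hv.trans_lt ((hα i).trans_lt i.2))
    | right j =>
      rcases lt_or_ge v n with hvn | hvn
      · exact hsmall v hvn
      · obtain ⟨i, hi⟩ := hsuffix v (Or.inr hvn) j hv
        exact ⟨_, hi⟩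
  · intro i j
    rw [hright, hright, Nat.nth_lt_nth hinf]
  · intro v hv hne
    refine htwice v hv fun hc => ?_
    obtain ⟨i, hi⟩ := hsuffix v (Or.inl ⟨hv, hc⟩) 0 (hv.le.trans hzero.symm.le)
    exact hne i hi
  · refine Prod.ext (funext hleft) (funext fun v => ?_)
    have hiff : (toColoured σ).2 v = Colour.blue ↔ c v = Colour.blue := by
      rw [toColoured_blue_iff]
      constructor
      · rintro ⟨j, hj⟩
        have hPv : P (σ (Fin.natAdd n j)) := by
          rw [hright]
          exact Nat.nth_mem_of_infinite hinf _
        rw [hj] at hPv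
        rcases hPv with ⟨_, h⟩ | h
        · exact h
        · exact absurd v.2 h.not_gt
      · exact fun hc => hsuffix v (Or.inl ⟨v.2, hc⟩) 0 (v.2.le.trans hzero.symm.le)
    change (toColoured σ).2 v = c v
    cases h : c v
    · exact hiff.2 h
    · rw [eq_red_iff] at h ⊢
      exact fun h' => h (hiff.1 h')

end InvSeq

theorem proposition5p1 (k m : ℕ) [NeZero k] (ρ : Fin k → ℕ) (hρ : InvSeq.IsCayleyPerm ρ)
    (hfirst : ρ 0 = m) (hmdd : InvSeq.mdd ρ = (m : ℤ)) (n : ℕ) :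
    {σ : Fin (n + k) → ℕ | InvSeq.IsMinimalFor ρ σ}.encard =
      (InvSeq.colouredSeqs n m).encard := by
  have hset : {σ : Fin (n + k) → ℕ | InvSeq.IsMinimalFor ρ σ} =
      {σ | InvSeq.IsReduced ρ σ} :=
    Set.ext fun σ => InvSeq.isMinimalFor_iff_isReduced hρ hfirst hmdd
  have himage : InvSeq.toColoured '' {σ : Fin (n + k) → ℕ | InvSeq.IsReduced ρ σ} =
      InvSeq.colouredSeqs n m := by
    ext x
    constructor
    · rintro ⟨σ, hσ, rfl⟩
      exact InvSeq.IsReduced.toColoured_mem hρ hfirst hσ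
    · exact fun hx => InvSeq.exists_isReduced_toColoured hρ hfirst hmdd hx
  rw [hset, ← himage, (InvSeq.injOn_toColoured hρ).encard_image]
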